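/- Let $\mathbb K\in\{\mathbb R,\mathbb C\}$ and let $m>2$ be an integer. Let $\Pi^*_{2^m}$ be the set of all polynomials $p\in\mathbb K[x]$ of degree at most $2^m$ such that, for a matrix $X$, $p(X)$ can be computed from the identity matrix $I$ and $X$ with $m$ matrix-matrix multiplications and an arbitrary number of linear combinations $Z\leftarrow\alpha P+\beta Q$ ($\alpha,\beta\in\mathbb K$); that is, $p$ is among the results of a finite sequence of steps which starts from the polynomials $1$ and $x$ and in which each step forms either a linear combination or a product of two available polynomials, exactly $m$ of the steps being products. Identify a polynomial of degree at most $2^m$ with its coefficient vector in $\mathbb K^{2^m+1}$. Then \[\dim(\Pi^*_{2^m})\le m^2,\] where the dimension of a subset $S\subseteq\mathbb K^{n}$ is the Krull dimension of $\mathbb K[y_1,\dots,y_n]/I(S)$, with $I(S)$ the ideal of all polynomials that vanish on $S$ (equivalently, the dimension of the Zariski closure of $S$; for $\mathbb K=\mathbb R$ this is the usual dimension of a semialgebraic set). -/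

import Mathlib

open Polynomial

/-- `Computes K m L`: starting from the identity `I` (the polynomial `1`) and the input matrix
(the polynomial `X`), all the polynomials in the list `L` are obtained by a computation whose steps
are linear combinations `α P + β Q` and products `P Q` of results that are already available,
exactly `m` of the steps being products. -/
inductive Computes (K : Type*) [Field K] : ℕ → List K[X] → Prop
  | init : Computes K 0 [1, X]
  | lin {m : ℕ} {L : List K[X]} (h : Computes K m L) (α β : K) {P Q : K[X]}
      (hP : P ∈ L) (hQ : Q ∈ L) : Computes K m ((α • P + β • Q) :: L)
  | mul {m : ℕ} {L : List K[X]} (h : Computes K m L) {P Q : K[X]}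
      (hP : P ∈ L) (hQ : Q ∈ L) : Computes K (m + 1) ((P * Q) :: L)

/-- The set `Π*_{2^m}` of the polynomials of degree at most `2 ^ m` that are computable with
`m` multiplications and arbitrarily many linear combinations. -/
def PiStar (K : Type*) [Field K] (m : ℕ) : Set K[X] :=
  {p | p.degree ≤ ((2 ^ m : ℕ) : WithBot ℕ) ∧ ∃ L : List K[X], Computes K m L ∧ p ∈ L}

/-- The coordinates of a polynomial of degree at most `d` in the monomial basis `1, x, …, x ^ d`. -/
def coeffVec (K : Type*) [Field K] (d : ℕ) (p : K[X]) : Fin (d + 1) → K :=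
  fun i => p.coeff i

/-- The dimension of a set `S` in the affine space `K ^ σ`: the Krull dimension of the ring
`K[x] / I(S)` of polynomial functions on `S`, where `I(S)` is the ideal of all polynomials vanishing
on `S`; that is, the dimension of the Zariski closure of `S`. For `K = ℝ` this is the usual
dimension of a semialgebraic set, for `K = ℂ` that of a constructible set. -/
noncomputable def affineDim {K : Type*} [Field K] {σ : Type*} (S : Set (σ → K)) : WithBot ℕ∞ :=
  ringKrullDim (MvPolynomial σ K ⧸ MvPolynomial.vanishingIdeal K S)

/-!
The results of all computations with `m` products are covered by finitely many families which depend
polynomially on `m ^ 2` parameters. Such a set has dimension at most `m ^ 2`: the ideal of the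
polynomials vanishing on it contains the intersection of the kernels of finitely many substitutions
into a polynomial ring in `m ^ 2` variables, and the quotient by each kernel is a finitely generated
domain of transcendence degree at most `m ^ 2`; see `affineDim_le_of_forall_exists_eval`.

The parameters are counted for computations in normal form. Only the span of `1` and of the available
polynomials `X, P₁, P₂, …` matters, so the factors of a product may be taken without constant terms
(`Covers.succ`) and with one coefficient equal to `1` (`exists_smul_normComb_eq_sum`). The product
after `X, P₁, …, Pₘ` then costs `2 * m` parameters. The first products are cheaper: `P₁` can be taken
to be `X²` (no parameter), `P₂` to be `X⁴ + e X³` or `X³` (one parameter,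
`exists_isParam_covers_two`), and `P₃` costs three parameters instead of four
(`exists_isParam_covers_three`). So the tuples `X, P₁, …, Pₘ` with `m ≥ 3` take
`1 + 3 + ∑ i ∈ [3, m), 2 * i = m ^ 2 - m - 2` parameters, and the `m + 2` coefficients of the final
linear combination bring the total to `m ^ 2`. The number of families is finite because
a family is determined by the positions of the coefficients that are normalized to `1`, together
with the choice between the two forms of `P₂`.
-/

/-! ### Krull dimension of polynomially parametrized sets -/

theorem ringKrullDim_le_of_isIntegral (R A : Type*) [CommRing R] [CommRing A] [Algebra R A]
    [Algebra.IsIntegral R A] : ringKrullDim A ≤ ringKrullDim R :=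
  Order.krullDim_le_of_strictMono (PrimeSpectrum.comap (algebraMap R A)) fun _ _ h =>
    Ideal.IsIntegral.comap_lt_comap h

/-- The coordinate ring of the closure of a polynomially parametrized variety embeds into the ring
of polynomials in the parameters. By Noether normalization it is integral over a polynomial ring
in `s` variables, and comparing transcendence degrees bounds `s` by the number of parameters. -/
theorem ringKrullDim_quotient_ker_le {K : Type*} [Field K] {σ : Type} [Finite σ] {n : ℕ}
    (φ : MvPolynomial (Fin n) K →ₐ[K] MvPolynomial σ K) :
    ringKrullDim (MvPolynomial (Fin n) K ⧸ RingHom.ker φ) ≤ (Nat.card σ : WithBot ℕ∞) := by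
  obtain ⟨s, -, g, hg, hint⟩ :=
    exists_integral_inj_algHom_of_quotient (RingHom.ker φ) (RingHom.ker_ne_top _)
  have hinj : Function.Injective ((Ideal.kerLiftAlg φ).comp g) :=
    (Ideal.kerLiftAlg_injective φ).comp hg
  have hs : s ≤ Nat.card σ := by
    have h := lift_trdeg_le_of_injective _ hinj
    simp only [MvPolynomial.trdeg_of_isDomain, Cardinal.lift_id] at h
    have _ := Fintype.ofFinite σ
    simpa [Cardinal.mk_fintype] using h
  let _ := g.toRingHom.toAlgebra
  have : Algebra.IsIntegral (MvPolynomial (Fin s) K)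
      (MvPolynomial (Fin n) K ⧸ RingHom.ker φ) := ⟨hint⟩
  calc ringKrullDim (MvPolynomial (Fin n) K ⧸ RingHom.ker φ)
      ≤ ringKrullDim (MvPolynomial (Fin s) K) := ringKrullDim_le_of_isIntegral _ _
    _ = (s : WithBot ℕ∞) := by
      rw [MvPolynomial.ringKrullDim_of_isNoetherianRing, ringKrullDim_eq_zero_of_field]; simp
    _ ≤ (Nat.card σ : WithBot ℕ∞) := by exact_mod_cast hs

/-- Geometrically: a closed set covered by finitely many closed sets has at most the largest of
their dimensions. -/
theorem ringKrullDim_quotient_le_of_biInf_le {R ι : Type*} [CommRing R] {s : Set ι}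
    (hs : s.Finite) (I : Ideal R) (J : ι → Ideal R) (hJ : ⨅ i ∈ s, J i ≤ I) {d : WithBot ℕ∞}
    (hd : ∀ i ∈ s, ringKrullDim (R ⧸ J i) ≤ d) : ringKrullDim (R ⧸ I) ≤ d := by
  rw [ringKrullDim_quotient, Order.krullDim]
  refine iSup_le fun l => ?_
  -- The smallest prime of the chain contains one of the `J i`, hence so do all the others.
  have hmem : I ≤ l.head.1.asIdeal := l.head.2
  obtain ⟨i, hi, hle⟩ : ∃ i ∈ s, J i ≤ l.head.1.asIdeal := by
    have := hJ.trans hmem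
    rw [← hs.coe_toFinset] at this
    simp only [Finset.mem_coe] at this
    rw [← Finset.inf_eq_iInf, Ideal.IsPrime.inf_le' l.head.1.isPrime] at this
    simpa using this
  refine le_trans ?_ (hd i hi)
  rw [ringKrullDim_quotient]
  let l' : LTSeries (PrimeSpectrum.zeroLocus (J i : Set R)) :=
    { length := l.length
      toFun := fun k => ⟨(l k).1, fun x hx => (l.head_le k : l.head.1 ≤ (l k).1) (hle hx)⟩
      step := fun k => l.step k }
  exact Order.LTSeries.length_le_krullDim l'

/-- A set covered by the images of finitely many polynomial maps from `K ^ σ` has dimension at most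
the cardinality of `σ`. -/
theorem affineDim_le_of_forall_exists_eval {K : Type*} [Field K] {n : ℕ} {σ : Type} [Finite σ]
    {F : Set (Fin n → MvPolynomial σ K)} (hF : F.Finite) {S : Set (Fin n → K)}
    (hS : ∀ x ∈ S, ∃ f ∈ F, ∃ t : σ → K, ∀ i, x i = MvPolynomial.eval t (f i)) :
    affineDim S ≤ (Nat.card σ : WithBot ℕ∞) := by
  -- `I(S)` contains every polynomial that lies in the kernels of all the substitutions `y ↦ f`.
  refine ringKrullDim_quotient_le_of_biInf_le hF _
    (fun f => RingHom.ker (MvPolynomial.aeval (R := K) f)) ?_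
    (fun f _ => ringKrullDim_quotient_ker_le (MvPolynomial.aeval f))
  intro p hp
  rw [MvPolynomial.mem_vanishingIdeal_iff]
  intro x hx
  obtain ⟨f, hf, t, ht⟩ := hS x hx
  have hpf : MvPolynomial.aeval (R := K) f p = 0 := by
    simp only [Ideal.mem_iInf, RingHom.mem_ker] at hp
    exact hp f hf
  have hcomp : (MvPolynomial.aeval (R := K) t).comp (MvPolynomial.aeval f) =
      MvPolynomial.aeval (R := K) x := by
    ext i
    simp [ht, MvPolynomial.aeval_eq_eval]
  rw [← hcomp, AlgHom.comp_apply, hpf, map_zero]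

/-! ### Polynomially parametrized families of tuples -/

/-- The tuples of polynomials in `T` are covered by finitely many families which depend polynomially
on at most `d` parameters: a family is a tuple `g` of polynomials whose coefficients are polynomials
in the parameters, and its members arise by evaluating the parameters at points of `K ^ σ`. -/
def IsParam {K : Type*} [Field K] {ι : Type} (d : ℕ) (T : Set (ι → K[X])) : Prop :=
  ∃ (σ : Type) (_ : Finite σ), Nat.card σ ≤ d ∧
    ∃ G : Set (ι → (MvPolynomial σ K)[X]), G.Finite ∧
      ∀ v ∈ T, ∃ g ∈ G, ∃ t : σ → K, ∀ i, v i = (g i).map (MvPolynomial.eval t)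

theorem IsParam.mono {K : Type*} [Field K] {ι : Type} {d d' : ℕ} {T : Set (ι → K[X])}
    (hT : IsParam d T) (h : d ≤ d') : IsParam d' T := by
  obtain ⟨σ, hfin, hσ, hG⟩ := hT
  exact ⟨σ, hfin, hσ.trans h, hG⟩

theorem isParam_singleton {K : Type*} [Field K] {ι : Type} (v : ι → K[X]) :
    IsParam 0 ({v} : Set (ι → K[X])) := by
  refine ⟨Empty, inferInstance, by simp, {fun i => (v i).map MvPolynomial.C},
    Set.finite_singleton _, ?_⟩
  rintro _ rfl
  refine ⟨_, rfl, Empty.elim, fun i => ?_⟩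
  ext a
  simp

/-- If the tuples in `T'` are obtained from those in `T` and new parameters `s : τ → K` by finitely
many polynomial formulas `Φ j`, then describing `T'` takes only the new parameters in addition. -/
theorem IsParam.extend {K : Type*} [Field K] {ι κ τ J : Type} [Finite τ] [Finite J] {d : ℕ}
    {T : Set (ι → K[X])} (hT : IsParam d T) (Φ : J → κ → MvPolynomial (ι ⊕ τ) K)
    {T' : Set (κ → K[X])}
    (h : ∀ w ∈ T', ∃ v ∈ T, ∃ j, ∃ s : τ → K,
      ∀ k, w k = MvPolynomial.aeval (Sum.elim v fun a => C (s a)) (Φ j k)) :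
    IsParam (d + Nat.card τ) T' := by
  obtain ⟨σ, _, hσ, G, hG, hGT⟩ := hT
  let lift : (ι → (MvPolynomial σ K)[X]) → J → κ → (MvPolynomial (σ ⊕ τ) K)[X] := fun g j k =>
    MvPolynomial.aeval
      (Sum.elim (fun i => (g i).map (MvPolynomial.rename (R := K) (Sum.inl : σ → σ ⊕ τ)).toRingHom)
        fun a => C (MvPolynomial.X (Sum.inr a))) (Φ j k)
  refine ⟨σ ⊕ τ, inferInstance, ?_, Set.image2 lift G Set.univ,
    hG.image2 _ Set.finite_univ, fun w hw => ?_⟩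
  · rw [Nat.card_sum]; omega
  obtain ⟨v, hv, j, s, hw⟩ := h w hw
  obtain ⟨g, hg, t, hgv⟩ := hGT v hv
  refine ⟨_, Set.mem_image2_of_mem hg (Set.mem_univ j), Sum.elim t s, fun k => ?_⟩
  rw [hw k]
  -- Specializing the parameters commutes with the formulas.
  have hcomp : (Polynomial.mapAlgHom (MvPolynomial.aeval (R := K) (Sum.elim t s))).comp
      (MvPolynomial.aeval
        (Sum.elim (fun i => (g i).map (MvPolynomial.rename (R := K)
          (Sum.inl : σ → σ ⊕ τ)).toRingHom) fun a => C (MvPolynomial.X (Sum.inr a)))) =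
      MvPolynomial.aeval (R := K) (Sum.elim v fun a => C (s a)) := by
    ext x : 1
    rcases x with i | a
    · simp only [AlgHom.comp_apply, MvPolynomial.aeval_X, Sum.elim_inl, hgv,
        Polynomial.coe_mapAlgHom, Polynomial.map_map]
      congr 1
      ext x <;> simp
    · simp
  rw [← hcomp]
  rfl

/-- The case of `IsParam.extend` in which the formulas append one entry to a tuple. -/
theorem IsParam.snoc {K : Type*} [Field K] {τ J : Type} [Finite τ] [Finite J] {n d : ℕ}
    {T : Set (Fin n → K[X])} (hT : IsParam d T) (Ψ : J → MvPolynomial (Fin n ⊕ τ) K) :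
    IsParam (d + Nat.card τ) {w : Fin (n + 1) → K[X] | ∃ v ∈ T, ∃ j, ∃ s : τ → K,
      w = Fin.snoc v (MvPolynomial.aeval (Sum.elim v fun a => C (s a)) (Ψ j))} := by
  refine hT.extend (J := J) (fun j => Fin.snoc (fun i => MvPolynomial.X (Sum.inl i)) (Ψ j)) ?_
  rintro _ ⟨v, hv, j, s, rfl⟩
  refine ⟨v, hv, j, s, fun k => ?_⟩
  induction k using Fin.lastCases <;> simp

/-- The linear combination of the `w i` in which `w j` has coefficient `1` and the remaining entries
have coefficients `s`. The coefficients lie in the same ring as the entries, so that the definition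
commutes with ring homomorphisms. -/
def normComb {A : Type*} [CommRing A] {n : ℕ} (w : Fin (n + 1) → A) (j : Fin (n + 1))
    (s : Fin n → A) : A :=
  w j + ∑ i, s i * w (j.succAbove i)

theorem map_normComb {A B F : Type*} [CommRing A] [CommRing B] [FunLike F A B] [RingHomClass F A B]
    (φ : F) {n : ℕ} (w : Fin (n + 1) → A) (j : Fin (n + 1)) (s : Fin n → A) :
    φ (normComb w j s) = normComb (fun i => φ (w i)) j fun i => φ (s i) := by
  simp [normComb]

/-- Normalizing a nonzero coefficient to `1` saves one parameter; the remaining scalar is harmless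
because only spans matter. -/
theorem exists_smul_normComb_eq_sum {K : Type*} [Field K] {n : ℕ} (w : Fin (n + 1) → K[X])
    (c : Fin (n + 1) → K) :
    ∃ (a : K) (j : Fin (n + 1)) (s : Fin n → K),
      ∑ i, c i • w i = a • normComb w j fun i => C (s i) := by
  by_cases hc : ∃ j, c j ≠ 0
  · obtain ⟨j, hj⟩ := hc
    refine ⟨c j, j, fun i => (c j)⁻¹ * c (j.succAbove i), ?_⟩
    rw [Fin.sum_univ_succAbove _ j, normComb, smul_add, Finset.smul_sum]
    congr 1
    refine Finset.sum_congr rfl fun i _ => ?_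
    rw [← smul_eq_C_mul, smul_smul, mul_inv_cancel_left₀ hj]
  · push Not at hc
    exact ⟨0, 0, 0, by simp [hc]⟩

/-! ### Computations in normal form -/

/-- Every computation with `m` products takes place in the span of `1` and of the entries of some
tuple in `T`. -/
def Covers {K : Type*} [Field K] (m : ℕ) {n : ℕ} (T : Set (Fin n → K[X])) : Prop :=
  ∀ L : List K[X], Computes K m L →
    ∃ v ∈ T, ∀ p ∈ L, p ∈ Submodule.span K (insert 1 (Set.range v))

theorem covers_zero (K : Type*) [Field K] : Covers 0 ({![X]} : Set (Fin 1 → K[X])) := by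
  intro L hL
  refine ⟨_, rfl, ?_⟩
  obtain ⟨m, hm, h⟩ : ∃ m, 0 = m ∧ Computes K m L := ⟨0, rfl, hL⟩
  clear hL
  induction h with
  | init =>
    intro p hp
    apply Submodule.subset_span
    simpa [or_comm] using hp
  | lin h α β hP hQ ih =>
    intro p hp
    rcases List.mem_cons.1 hp with rfl | hp
    · exact add_mem (Submodule.smul_mem _ _ (ih hm _ hP)) (Submodule.smul_mem _ _ (ih hm _ hQ))
    · exact ih hm p hp
  | mul => simp at hm

/-- One more product. Constant terms of the two factors contribute only elements of the span
available before, so only products of combinations of the entries of `v` have to be reached, and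
these only modulo the span of `v` and up to a scalar. -/
theorem Covers.succ {K : Type*} [Field K] {m n : ℕ} {T : Set (Fin n → K[X])}
    {T' : Set (Fin (n + 1) → K[X])} (hT : Covers m T)
    (h : ∀ v ∈ T, ∀ a b : Fin n → K, ∃ Q, Fin.snoc v Q ∈ T' ∧ ∃ c : K,
      (∑ i, a i • v i) * (∑ i, b i • v i) - c • Q ∈ Submodule.span K (Set.range v)) :
    Covers (m + 1) T' := by
  intro L hL
  generalize hm : m + 1 = m' at hL
  induction hL with
  | init => simp at hm
  | lin h α β hP hQ ih =>
    obtain ⟨v, hv, hL⟩ := ih hm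
    refine ⟨v, hv, fun p hp => ?_⟩
    rcases List.mem_cons.1 hp with rfl | hp
    · exact add_mem (Submodule.smul_mem _ _ (hL _ hP)) (Submodule.smul_mem _ _ (hL _ hQ))
    · exact hL p hp
  | @mul m₁ L hL P Q hP hQ =>
    obtain rfl : m = m₁ := by omega
    obtain ⟨v, hv, hvL⟩ := hT L hL
    obtain ⟨a₀, A, hA, rfl⟩ := Submodule.mem_span_insert.1 (hvL P hP)
    obtain ⟨b₀, B, hB, rfl⟩ := Submodule.mem_span_insert.1 (hvL Q hQ)
    have hA' := hA
    have hB' := hB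
    rw [Submodule.mem_span_range_iff_exists_fun] at hA' hB'
    obtain ⟨a, rfl⟩ := hA'
    obtain ⟨b, rfl⟩ := hB'
    obtain ⟨R, hR, c, hc⟩ := h v hv a b
    let V := Submodule.span K (insert 1 (Set.range (Fin.snoc v R : Fin (n + 1) → K[X])))
    have hle : Submodule.span K (Set.range v) ≤ V := by
      refine Submodule.span_mono (Set.Subset.trans ?_ (Set.subset_insert _ _))
      rintro _ ⟨i, rfl⟩
      exact ⟨i.castSucc, by simp⟩
    have h1 : (1 : K[X]) ∈ V :=
      Submodule.subset_span (Set.mem_insert _ _)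
    have hle' : Submodule.span K (insert 1 (Set.range v)) ≤ V := by
      rw [Submodule.span_le]
      rintro x (rfl | hx)
      · exact h1
      · exact hle (Submodule.subset_span hx)
    have hRmem : R ∈ V :=
      Submodule.subset_span (Set.mem_insert_of_mem _ ⟨Fin.last n, by simp⟩)
    refine ⟨_, hR, fun p hp => ?_⟩
    rcases List.mem_cons.1 hp with rfl | hp
    · have key : (a₀ • (1 : K[X]) + ∑ i, a i • v i) * (b₀ • (1 : K[X]) + ∑ i, b i • v i) =
          (a₀ * b₀) • (1 : K[X]) + a₀ • ∑ i, b i • v i + b₀ • ∑ i, a i • v i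
            + (((∑ i, a i • v i) * (∑ i, b i • v i) - c • R) + c • R) := by
        simp only [smul_eq_C_mul, C_mul]
        ring
      rw [key]
      exact add_mem (add_mem (add_mem (Submodule.smul_mem _ _ h1)
        (Submodule.smul_mem _ _ (hle hB))) (Submodule.smul_mem _ _ (hle hA)))
        (add_mem (hle hc) (Submodule.smul_mem _ _ hRmem))
    · exact hle' (hvL p hp)

theorem covers_one (K : Type*) [Field K] : Covers 1 ({![X, X ^ 2]} : Set (Fin 2 → K[X])) := by
  refine (covers_zero K).succ fun v hv a b => ⟨X ^ 2, ?_, a 0 * b 0, ?_⟩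
  · rw [Set.mem_singleton_iff.1 hv]
    refine Set.mem_singleton_iff.2 ?_
    ext i : 1
    fin_cases i <;> rfl
  · rw [Set.mem_singleton_iff.1 hv]
    convert! Submodule.zero_mem _
    simp [smul_eq_C_mul]
    ring

/-- Since `(a₀ X + a₁ X²) (b₀ X + b₁ X²)` is a combination of `X²`, `X³`, `X⁴`, the second product
can be replaced by `X⁴ + e X³` or by `X³`: a single parameter. -/
theorem exists_isParam_covers_two (K : Type*) [Field K] :
    ∃ T : Set (Fin 3 → K[X]), IsParam 1 T ∧ Covers 2 T ∧
      ∀ v ∈ T, v 0 = X ∧ v 1 = X ^ 2 ∧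
        ((∃ e : K, v 2 = X ^ 4 + e • X ^ 3) ∨ v 2 = X ^ 3) := by
  let Ψ : Fin 2 → MvPolynomial (Fin 2 ⊕ Unit) K :=
    ![MvPolynomial.X (Sum.inl 0) ^ 4 +
        MvPolynomial.X (Sum.inr ()) * MvPolynomial.X (Sum.inl 0) ^ 3,
      MvPolynomial.X (Sum.inl 0) ^ 3]
  refine ⟨_, ((isParam_singleton ![(X : K[X]), X ^ 2]).snoc Ψ).mono (by simp),
    (covers_one K).succ fun v hv a b => ?_, ?_⟩
  · rw [Set.mem_singleton_iff.1 hv]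
    have hX2 : (X : K[X]) ^ 2 ∈ Submodule.span K (Set.range ![(X : K[X]), X ^ 2]) :=
      Submodule.subset_span ⟨1, rfl⟩
    by_cases h : a 1 * b 1 = 0
    · refine ⟨X ^ 3, ⟨_, rfl, 1, 0, by simp [Ψ]⟩, a 0 * b 1 + a 1 * b 0, ?_⟩
      convert! Submodule.smul_mem _ (a 0 * b 0) hX2 using 1
      have h' : (C (a 1) * C (b 1) : K[X]) = 0 := by rw [← C_mul, h, C_0]
      simp only [Fin.sum_univ_two, Matrix.cons_val_zero, Matrix.cons_val_one, smul_eq_C_mul,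
        C_add, C_mul]
      linear_combination X ^ 4 * h'
    · refine ⟨X ^ 4 + ((a 1 * b 1)⁻¹ * (a 0 * b 1 + a 1 * b 0)) • X ^ 3,
        ⟨_, rfl, 0, fun _ => (a 1 * b 1)⁻¹ * (a 0 * b 1 + a 1 * b 0), by
          simp [Ψ, smul_eq_C_mul]⟩, a 1 * b 1, ?_⟩
      convert! Submodule.smul_mem _ (a 0 * b 0) hX2 using 1
      rw [smul_add, smul_smul, mul_inv_cancel_left₀ h]
      simp only [Fin.sum_univ_two, Matrix.cons_val_zero, Matrix.cons_val_one, smul_eq_C_mul,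
        C_add, C_mul]
      ring
  · rintro _ ⟨v, hv, j, s, rfl⟩
    obtain rfl := Set.mem_singleton_iff.1 hv
    refine ⟨rfl, rfl, ?_⟩
    fin_cases j
    · exact Or.inl ⟨s (), by simp [Ψ, Fin.snoc, smul_eq_C_mul]⟩
    · exact Or.inr (by simp [Ψ, Fin.snoc])

/-- The third product can be replaced by a combination of `P²`, `X² P`, `X P`, `X³`, where `P` is the
second one, because modulo `P` the monomial `X⁴` is a multiple of `X³`, or is `X P` if `P = X³`.
After normalizing a coefficient this costs three parameters, whereas two normalized factors would
cost four. -/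
theorem exists_isParam_covers_three (K : Type*) [Field K] :
    ∃ T : Set (Fin 4 → K[X]), IsParam 4 T ∧ Covers 3 T := by
  obtain ⟨T, hT, hcov, hform⟩ := exists_isParam_covers_two K
  let W (A : Type _) [CommRing A] (x : Fin 3 → A) : Fin 4 → A :=
    ![x 2 ^ 2, x 1 * x 2, x 0 * x 2, x 0 ^ 3]
  let Ψ : Fin 4 → MvPolynomial (Fin 3 ⊕ Fin 3) K := fun j =>
    normComb (W _ fun i => MvPolynomial.X (Sum.inl i)) j fun i => MvPolynomial.X (Sum.inr i)
  have hΨ (v : Fin 3 → K[X]) (j : Fin 4) (s : Fin 3 → K) :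
      MvPolynomial.aeval (Sum.elim v fun a => C (s a)) (Ψ j) =
        normComb (W _ v) j fun i => C (s i) := by
    rw [map_normComb]
    congr 1
    · ext i : 1
      fin_cases i <;> simp [W]
    · simp
  refine ⟨_, (hT.snoc Ψ).mono (by simp), hcov.succ fun v hv a b => ?_⟩
  -- The product is a combination of the four products in `W` modulo the span of `v`.
  obtain ⟨c, hc⟩ : ∃ c : Fin 4 → K, (∑ i, a i • v i) * (∑ i, b i • v i) - ∑ i, c i • W _ v i ∈
      Submodule.span K (Set.range v) := by
    obtain ⟨h0, h1, h2⟩ := hform v hv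
    have hv1 : v 1 ∈ Submodule.span K (Set.range v) := Submodule.subset_span ⟨1, rfl⟩
    have hv2 : v 2 ∈ Submodule.span K (Set.range v) := Submodule.subset_span ⟨2, rfl⟩
    rcases h2 with ⟨e, h2⟩ | h2
    · refine ⟨![a 2 * b 2, a 1 * b 2 + a 2 * b 1, a 0 * b 2 + a 2 * b 0,
        a 0 * b 1 + a 1 * b 0 - e * (a 1 * b 1)], ?_⟩
      convert! add_mem (Submodule.smul_mem _ (a 1 * b 1) hv2)
        (Submodule.smul_mem _ (a 0 * b 0) hv1) using 1
      simp [Fin.sum_univ_succ, W, h0, h1, h2, smul_eq_C_mul]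
      ring
    · refine ⟨![a 2 * b 2, a 1 * b 2 + a 2 * b 1, a 0 * b 2 + a 2 * b 0 + a 1 * b 1,
        a 0 * b 1 + a 1 * b 0], ?_⟩
      convert! Submodule.smul_mem _ (a 0 * b 0) hv1 using 1
      simp [Fin.sum_univ_succ, W, h0, h1, h2, smul_eq_C_mul]
      ring
  obtain ⟨r, j, s, hr⟩ := exists_smul_normComb_eq_sum (W _ v) c
  exact ⟨_, ⟨v, hv, j, s, rfl⟩, r, by rwa [hΨ, ← hr]⟩

/-- Each of the two factors of a further product has `n + 1` coefficients, one of which can be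
normalized to `1`. -/
theorem exists_isParam_covers_succ {K : Type*} [Field K] {m d n : ℕ}
    {T : Set (Fin (n + 1) → K[X])} (hT : IsParam d T) (hcov : Covers m T) :
    ∃ T' : Set (Fin (n + 2) → K[X]), IsParam (d + 2 * n) T' ∧ Covers (m + 1) T' := by
  let Ψ : Fin (n + 1) × Fin (n + 1) → MvPolynomial (Fin (n + 1) ⊕ (Fin n ⊕ Fin n)) K := fun j =>
    normComb (fun i => MvPolynomial.X (Sum.inl i)) j.1 (fun i => MvPolynomial.X (Sum.inr (.inl i)))
    * normComb (fun i => MvPolynomial.X (Sum.inl i)) j.2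
      fun i => MvPolynomial.X (Sum.inr (.inr i))
  refine ⟨_, (hT.snoc Ψ).mono (by simp [two_mul]), hcov.succ fun v hv a b => ?_⟩
  obtain ⟨r, j, s, hr⟩ := exists_smul_normComb_eq_sum v a
  obtain ⟨r', j', s', hr'⟩ := exists_smul_normComb_eq_sum v b
  refine ⟨_, ⟨v, hv, (j, j'), Sum.elim s s', rfl⟩, r * r', ?_⟩
  convert! Submodule.zero_mem _
  rw [hr, hr', map_mul, map_normComb, map_normComb, smul_mul_smul_comm]
  simp

/-- With `m = k + 3`, the number of parameters is `m ^ 2 - m - 2 = (k + 1) * (k + 4)`. -/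
theorem exists_isParam_covers (K : Type*) [Field K] (k : ℕ) :
    ∃ T : Set (Fin (k + 4) → K[X]), IsParam ((k + 1) * (k + 4)) T ∧ Covers (k + 3) T := by
  induction k with
  | zero => exact exists_isParam_covers_three K
  | succ k ih =>
    obtain ⟨T, hT, hcov⟩ := ih
    obtain ⟨T', hT', hcov'⟩ := exists_isParam_covers_succ hT hcov
    refine ⟨T', ?_, hcov'⟩
    convert! hT' using 1
    ring

/-! ### The dimension of the set of computable polynomials -/

theorem affineDim_image_coeffVec_le {K : Type*} [Field K] {d e : ℕ} {S : Set K[X]}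
    {T : Set (Unit → K[X])} (hT : IsParam d T) (hS : ∀ p ∈ S, (fun _ => p) ∈ T) :
    affineDim (coeffVec K e '' S) ≤ (d : WithBot ℕ∞) := by
  obtain ⟨σ, _, hσ, G, hG, hGT⟩ := hT
  refine (affineDim_le_of_forall_exists_eval
    (hG.image fun g (i : Fin (e + 1)) => (g ()).coeff i) ?_).trans (by exact_mod_cast hσ)
  rintro _ ⟨p, hp, rfl⟩
  obtain ⟨g, hg, t, ht⟩ := hGT _ (hS p hp)
  refine ⟨_, Set.mem_image_of_mem _ hg, t, fun i => ?_⟩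
  rw [coeffVec, show p = _ from ht (), coeff_map]

theorem mainTheorem1 (K : Type*) [RCLike K] (m : ℕ) (hm : 2 < m) :
    affineDim (coeffVec K (2 ^ m) '' PiStar K m) ≤ ((m ^ 2 : ℕ) : WithBot ℕ∞) := by
  obtain ⟨k, rfl⟩ : ∃ k, m = k + 3 := ⟨m - 3, by omega⟩
  obtain ⟨T, hT, hcov⟩ := exists_isParam_covers K k
  -- The output is a combination of `1` and of the entries of the tuple: `k + 5 = m + 2` further
  -- parameters, with `none` indexing the coefficient of `1`.
  let Φ : Unit → Unit → MvPolynomial (Fin (k + 4) ⊕ Option (Fin (k + 4))) K := fun _ _ =>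
    MvPolynomial.X (Sum.inr none) +
      ∑ i, MvPolynomial.X (Sum.inr (some i)) * MvPolynomial.X (Sum.inl i)
  have hT' : IsParam ((k + 1) * (k + 4) + Nat.card (Option (Fin (k + 4))))
      {w : Unit → K[X] | w () ∈ PiStar K (k + 3)} := by
    refine hT.extend Φ fun w hw => ?_
    obtain ⟨-, L, hL, hp⟩ := hw
    obtain ⟨v, hv, hvL⟩ := hcov L hL
    obtain ⟨c, q, hq, hw⟩ := Submodule.mem_span_insert.1 (hvL _ hp)
    obtain ⟨a, rfl⟩ := (Submodule.mem_span_range_iff_exists_fun K).1 hq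
    refine ⟨v, hv, (), fun o => o.elim c a, fun _ => ?_⟩
    simp [hw, Φ, smul_eq_C_mul]
  refine affineDim_image_coeffVec_le (hT'.mono ?_) fun p hp => hp
  rw [Nat.card_eq_fintype_card, Fintype.card_option, Fintype.card_fin]
  exact le_of_eq (by ring)
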